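/- Let $R$ be a complete discrete valuation ring with field of fractions $F$ and residue field $k$ with $\operatorname{char}(k)\neq 2$. For nonzero $a,b\in R$ let $R(a,b)$ be the $R$-algebra generated by $i,j$ with $i^2=a$, $j^2=b$, $ij=-ji$ (it is free of rank $4$ over $R$ with basis $1,i,j,ij$), and let $(a,b)=F\otimes_R R(a,b)$ be the corresponding quaternion algebra over $F$. Recall that an $R$-order in a finite-dimensional $F$-algebra $A$ is a subring of $A$ (with the same identity) that is a finitely generated $R$-submodule of $A$ and spans $A$ over $F$; it is maximal if it is not properly contained in another $R$-order in $A$. Let $\Gamma_0$ be an Azumaya algebra over $R$, put $D_0=\Gamma_0\otimes_R F$, let $u\in R$ be a unit and let $\pi\in R$ be a parameter (a generator of the maximal ideal of $R$). If $D=D_0\otimes_F(u,\pi)$ is a division algebra, then the canonical map $\Gamma_0\otimes_R R(u,\pi)\to D$ is injective, and its image $\Gamma$ is the unique maximal $R$-order in $D$; that is, $\Gamma$ is a maximal $R$-order in $D$, and every maximal $R$-order in $D$ is equal to $\Gamma$. -/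

import Mathlib

open scoped TensorProduct Quaternion

section Orders

variable (R F : Type*) {A : Type*} [CommRing R] [Field F] [Algebra R F] [Ring A]
  [Algebra R A] [Algebra F A] [IsScalarTower R F A]

/-- An `R`-order in the `F`-algebra `A`: a subring of `A` (with the same `1`) which is
a finitely generated `R`-submodule and spans `A` over `F`. -/
structure IsOrderIn (Λ : Subalgebra R A) : Prop where
  fg : (Subalgebra.toSubmodule Λ).FG
  span_eq_top : Submodule.span F (Λ : Set A) = ⊤

/-- A maximal `R`-order: an `R`-order which is not properly contained in another one. -/
structure IsMaximalOrderIn (Λ : Subalgebra R A) : Prop where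
  isOrder : IsOrderIn R F Λ
  eq_of_le : ∀ Λ' : Subalgebra R A, IsOrderIn R F Λ' → Λ ≤ Λ' → Λ = Λ'

end Orders

/-- A (not necessarily commutative) ring is a division ring: it is nonzero and every nonzero
element is a (two-sided) unit. -/
def IsDivision (A : Type*) [Ring A] : Prop :=
  Nontrivial A ∧ ∀ x : A, x ≠ 0 → IsUnit x

noncomputable section

variable {R : Type*} (F Γ₀ : Type*) [CommRing R] [Field F] [Algebra R F]
  [Ring Γ₀] [Algebra R Γ₀] (a b : R)

/-- The quaternion algebra `(a, b)` over `F` for `a b : R`: generators `i`, `j` with `i² = a`,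
`j² = b`, `ij = -ji`. -/
abbrev QuatOver : Type _ := ℍ[F, algebraMap R F a, algebraMap R F b]

/-- The `R`-algebra homomorphism `R(a, b) → (a, b)_F`, sending `i` to `i` and `j` to `j`. -/
def quatMap : ℍ[R, a, b] →ₐ[R] QuatOver F a b where
  toFun x := ⟨algebraMap R F x.re, algebraMap R F x.imI, algebraMap R F x.imJ,
    algebraMap R F x.imK⟩
  map_one' := by ext <;> simp
  map_mul' x y := by ext <;> simp
  map_zero' := by ext <;> simp
  map_add' x y := by ext <;> simp
  commutes' r := by
    change _ = (⟨algebraMap R F r, 0, 0, 0⟩ : QuatOver F a b)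
    ext <;> simp [QuaternionAlgebra.algebraMap_eq]

/-- `D = D₀ ⊗_F (a, b)`, where `D₀ = F ⊗_R Γ₀`. -/
abbrev QuatTwist : Type _ := (F ⊗[R] Γ₀) ⊗[F] QuatOver F a b

/-- The canonical `R`-algebra homomorphism `Γ₀ → D₀ ⊗_F (a, b)`, `x ↦ (1 ⊗ x) ⊗ 1`. -/
def quatTwistLeft : Γ₀ →ₐ[R] QuatTwist F Γ₀ a b :=
  (Algebra.TensorProduct.includeLeft : (F ⊗[R] Γ₀) →ₐ[R] QuatTwist F Γ₀ a b).comp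
    (Algebra.TensorProduct.includeRight : Γ₀ →ₐ[R] F ⊗[R] Γ₀)

/-- The canonical `R`-algebra homomorphism `R(a, b) → D₀ ⊗_F (a, b)`, `q ↦ 1 ⊗ q`. -/
def quatTwistRight : ℍ[R, a, b] →ₐ[R] QuatTwist F Γ₀ a b :=
  ((Algebra.TensorProduct.includeRight :
    QuatOver F a b →ₐ[F] QuatTwist F Γ₀ a b).restrictScalars R).comp (quatMap F a b)

theorem quatTwist_commute (x : Γ₀) (q : ℍ[R, a, b]) :
    Commute (quatTwistLeft F Γ₀ a b x) (quatTwistRight F Γ₀ a b q) := by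
  simp [quatTwistLeft, quatTwistRight, Commute, SemiconjBy]

/-- The canonical `R`-algebra homomorphism `Γ₀ ⊗_R R(a, b) → D₀ ⊗_F (a, b)`,
`x ⊗ q ↦ (1 ⊗ x) ⊗ q`. -/
def quatTwistMap : Γ₀ ⊗[R] ℍ[R, a, b] →ₐ[R] QuatTwist F Γ₀ a b :=
  Algebra.TensorProduct.lift (quatTwistLeft F Γ₀ a b) (quatTwistRight F Γ₀ a b)
    (quatTwist_commute F Γ₀ a b)

theorem quatTwistMap_tmul (x : Γ₀) (q : ℍ[R, a, b]) :
    quatTwistMap F Γ₀ a b (x ⊗ₜ[R] q) = ((1 : F) ⊗ₜ[R] x) ⊗ₜ[F] quatMap F a b q := by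
  rw [quatTwistMap, Algebra.TensorProduct.lift_tmul]
  simp [quatTwistLeft, quatTwistRight]

end

/-! Write `T = Γ₀ ⊗ R(u, π)`. A basis of `T` over `R` maps to a basis of `D` over `F`, so `T` embeds
in `D` as an order and is a domain, as is `Γ₀`. By completeness, idempotents modulo `π` lift, so
neither `T/πT` nor `Γ₀/πΓ₀` has nontrivial ones. Since `Γ₀/πΓ₀` is simple Artinian, it is a division
ring (`IsAzumaya.isUnit_of_not_smul`). Because `2` and `u` are units, the same absence of
idempotents makes every `a + bi` outside `πT` a unit. As `j² = π`, every element of `T` is then a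
unit or lies in `Tj` (`QuatExt.isUnit_or_exists_mul_j`): `j` acts as a uniformizer of a
noncommutative valuation ring. An element `d` of `D` outside `T` has its inverse in `jT`, so the
powers of `d` have unbounded denominators and `d` lies in no order (`QuatExt.le_range_of_fg`). Hence
`T` contains every order, which gives both maximality and uniqueness. -/

/-! ### Limits in finite free modules over a complete ring. -/

section Completeness

variable {R M : Type*} [CommRing R] [AddCommGroup M] [Module R M]
  [Module.Free R M] [Module.Finite R M] {I : Ideal R} {π : R}

theorem Ideal.smodEq_span_singleton_pow_iff (hI : I = Ideal.span {π}) (n : ℕ) (x y : R) :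
    x ≡ y [SMOD (I ^ n • ⊤ : Submodule R R)] ↔ π ^ n ∣ x - y := by
  rw [SModEq.sub_mem, hI, Ideal.span_singleton_pow, smul_eq_mul, Ideal.mul_top,
    Ideal.mem_span_singleton]

theorem Module.Free.exists_limit [IsPrecomplete I R] (hI : I = Ideal.span {π})
    (f : ℕ → M) (hf : ∀ n, ∃ y, f (n + 1) - f n = π ^ n • y) :
    ∃ L : M, ∀ n, ∃ y, L - f n = π ^ n • y := by
  classical
  let b := Module.Free.chooseBasis R M
  choose y hy using hf
  have hstep : ∀ i m n, m ≤ n → π ^ m ∣ b.repr (f m) i - b.repr (f n) i := by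
    intro i m n hmn
    induction n, hmn using Nat.le_induction with
    | base => simp
    | succ n hmn ih =>
      have h := congrArg (fun v => b.repr v i) (hy n)
      simp only [map_sub, map_smul, Finsupp.sub_apply, Finsupp.smul_apply, smul_eq_mul] at h
      have h2 : π ^ m ∣ π ^ n * b.repr (y n) i := (pow_dvd_pow π hmn).mul_right _
      have h3 : b.repr (f m) i - b.repr (f (n + 1)) i =
        (b.repr (f m) i - b.repr (f n) i) - π ^ n * b.repr (y n) i := by rw [← h]; ring
      rw [h3]
      exact dvd_sub ih h2
  have hlim : ∀ i, ∃ l : R, ∀ n, π ^ n ∣ b.repr (f n) i - l := by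
    intro i
    obtain ⟨l, hl⟩ := IsPrecomplete.prec (I := I) (M := R) inferInstance
      (f := fun n => b.repr (f n) i)
      (fun {m n} hmn => (Ideal.smodEq_span_singleton_pow_iff hI m _ _).2 (hstep i m n hmn))
    exact ⟨l, fun n => (Ideal.smodEq_span_singleton_pow_iff hI n _ _).1 (hl n)⟩
  choose l hl using hlim
  choose c hc using hl
  refine ⟨b.equivFun.symm l, fun n => ⟨b.equivFun.symm fun i => -c i n, ?_⟩⟩
  apply b.equivFun.injective
  ext i
  have h := hc i n
  simp only [map_sub, map_smul, LinearEquiv.apply_symm_apply, Pi.sub_apply, Pi.smul_apply,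
    smul_eq_mul, Module.Basis.equivFun_apply]
  linear_combination -h

omit [Module.Finite R M] in
theorem Module.Free.eq_zero_of_forall_pow_smul [IsHausdorff I R] (hI : I = Ideal.span {π})
    (x : M) (hx : ∀ n : ℕ, ∃ y, x = π ^ n • y) : x = 0 := by
  let b := Module.Free.chooseBasis R M
  apply b.repr.injective
  ext i
  rw [map_zero, Finsupp.zero_apply]
  refine IsHausdorff.haus (I := I) (M := R) inferInstance _ fun n => ?_
  obtain ⟨y, rfl⟩ := hx n
  rw [Ideal.smodEq_span_singleton_pow_iff hI]
  simp

end Completeness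

/-! ### Lifting idempotents modulo `π`. -/

section IdempotentLifting

variable {R B : Type*} [CommRing R] [Ring B] [Algebra R B]
  [Module.Free R B] [Module.Finite R B] {I : Ideal R} {π : R}

/-- Newton iteration of `3x² - 2x³` squares the error `x² - x` up to a factor, and its limit is
idempotent. -/
theorem exists_isIdempotentElem_lift [IsAdicComplete I R] (hI : I = Ideal.span {π})
    (e y : B) (he : e * e - e = π • y) :
    ∃ L : B, L * L = L ∧ ∃ z, L - e = π • z := by
  let N : B → B := fun x => 3 • (x * x) - 2 • (x * x * x)
  let f : ℕ → B := fun n => N^[n] e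
  have hsucc : ∀ n, f (n + 1) = N (f n) := fun n => Function.iterate_succ_apply' N n e
  have hN1 : ∀ x : B, N x - x = (x * x - x) * (1 - 2 • x) := fun x => by
    simp only [N]; noncomm_ring
  have hN2 : ∀ x : B, N x * N x - N x =
      (x * x - x) * (x * x - x) * (4 • (x * x) - 4 • x - 3) := fun x => by
    simp only [N]; noncomm_ring
  have hidem : ∀ n, ∃ y, f n * f n - f n = π ^ (n + 1) • y := by
    intro n
    induction n with
    | zero => exact ⟨y, by simpa [f] using he⟩
    | succ n ih =>
      obtain ⟨w, hw⟩ := ih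
      -- Squaring gives `π ^ (2n + 2)`; only `π ^ (n + 2)` is needed, so `π ^ n` goes into the
      -- witness.
      refine ⟨π ^ n • (w * w * (4 • (f n * f n) - 4 • f n - 3)), ?_⟩
      rw [hsucc, hN2, hw]
      simp only [smul_mul_assoc, mul_smul_comm, smul_smul]
      congr 1
      ring
  have hdiff : ∀ n, ∃ y, f (n + 1) - f n = π ^ (n + 1) • y := by
    intro n
    obtain ⟨w, hw⟩ := hidem n
    exact ⟨w * (1 - 2 • f n), by rw [hsucc, hN1, hw, smul_mul_assoc]⟩
  obtain ⟨L, hL⟩ := Module.Free.exists_limit hI f fun n => by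
    obtain ⟨w, hw⟩ := hdiff n
    exact ⟨π • w, by rw [hw, pow_succ, mul_smul]⟩
  refine ⟨L, ?_, ?_⟩
  · rw [← sub_eq_zero]
    refine Module.Free.eq_zero_of_forall_pow_smul hI _ fun n => ?_
    obtain ⟨w, hw⟩ := hL n
    obtain ⟨v, hv⟩ := hidem n
    refine ⟨w * L + f n * w - w + π • v, ?_⟩
    have h : L * L - L = (L - f n) * L + f n * (L - f n) - (L - f n) + (f n * f n - f n) := by
      noncomm_ring
    rw [h, hw, hv, pow_succ, mul_smul]
    simp only [smul_mul_assoc, mul_smul_comm, smul_add, smul_sub]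
  -- Index `1` is used because the estimate for `L - f 0` only involves `π ^ 0`.
  · obtain ⟨w, hw⟩ := hL 1
    obtain ⟨v, hv⟩ := hdiff 0
    refine ⟨w + v, ?_⟩
    have h : L - e = (L - f 1) + (f (0 + 1) - f 0) := by simp [f]
    rw [h, hw, hv]
    simp

end IdempotentLifting

/-! ### Units modulo `π`. -/

section Units

variable {R B : Type*} [CommRing R] [IsLocalRing R] [Ring B] [Algebra R B] [Module.Finite R B]
  [IsDedekindFiniteMonoid B] {π : R}

/-- Here `xB + πB = B`, so Nakayama gives `xB = B`; Dedekind finiteness makes the right inverse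
two-sided. -/
theorem isUnit_of_mul_eq_one_add_smul (hπ : ¬ IsUnit π) {x y z : B} (h : x * y = 1 + π • z) :
    IsUnit x := by
  let N : Submodule R B := LinearMap.range (LinearMap.mulLeft R x)
  have hN : (⊤ : Submodule R B) ≤ N := by
    refine Submodule.le_of_le_smul_of_le_jacobson_bot (I := IsLocalRing.maximalIdeal R)
      Module.Finite.fg_top (IsLocalRing.maximalIdeal_le_jacobson _) fun w _ => ?_
    have hw : w = x * (y * w) + π • -(z * w) := by
      rw [← mul_assoc, h, add_mul, one_mul, smul_mul_assoc, smul_neg, add_neg_cancel_right]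
    rw [hw]
    exact Submodule.add_mem_sup ⟨y * w, rfl⟩
      (Submodule.smul_mem_smul ((IsLocalRing.mem_maximalIdeal π).2 hπ) trivial)
  obtain ⟨v, hv⟩ := hN (show (1 : B) ∈ _ from trivial)
  have hv : x * v = 1 := hv
  exact ⟨⟨x, v, hv, mul_eq_one_symm hv⟩, rfl⟩

end Units

/-! ### Azumaya algebras modulo `π`. -/

section Azumaya

variable {R A : Type*} [CommRing R] [IsDomain R] [IsDiscreteValuationRing R]
  [Ring A] [Algebra R A] [IsAzumaya R A] {π : R}

instance IsAzumaya.free_of_isDiscreteValuationRing : Module.Free R A :=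
  Module.free_of_flat_of_isLocalRing

/-- Some coordinate of `x` is a unit, so a rank-one endomorphism suffices. -/
theorem IsAzumaya.exists_end_apply_eq_one (hπ : Irreducible π) {x : A}
    (hx : ¬ ∃ y, x = π • y) : ∃ φ : Module.End R A, φ x = 1 := by
  let b := Module.Free.chooseBasis R A
  have h : ∃ i, IsUnit (b.repr x i) := by
    by_contra! hcon
    have hd : ∀ i, π ∣ b.repr x i := fun i => by
      have := (IsLocalRing.mem_maximalIdeal _).2 (hcon i)
      rwa [hπ.maximalIdeal_eq, Ideal.mem_span_singleton] at this
    choose c hc using hd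
    refine hx ⟨b.equivFun.symm c, b.equivFun.injective ?_⟩
    ext i
    rw [map_smul, LinearEquiv.apply_symm_apply, Pi.smul_apply, smul_eq_mul, ← hc i,
      Module.Basis.equivFun_apply]
  obtain ⟨i, v, hv⟩ := h
  refine ⟨(b.coord i).smulRight ((↑v⁻¹ : R) • (1 : A)), ?_⟩
  simp [← hv, smul_smul]

/-- In the semisimple ring `A/πA` the left ideal of `x` is generated by an idempotent, which `hid`
forces to be `0` or `1`; so `x` is left invertible modulo `π`. -/
theorem IsAzumaya.isUnit_of_not_smul [IsDedekindFiniteMonoid A] (hπ : Irreducible π)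
    (hid : ∀ e y : A, e * e - e = π • y → (∃ z, e = π • z) ∨ ∃ z, 1 - e = π • z)
    {x : A} (hx : ¬ ∃ y, x = π • y) : IsUnit x := by
  let I : Ideal A := Ideal.span {algebraMap R A π}
  have hmem : ∀ a, a ∈ I ↔ ∃ y, a = π • y := fun a => by
    simp only [I, Ideal.mem_span_singleton', Algebra.smul_def, Algebra.commutes, eq_comm]
  have hts : I.IsTwoSided := ⟨fun {a} b ha => by
    obtain ⟨y, rfl⟩ := (hmem a).1 ha
    exact (hmem _).2 ⟨y * b, smul_mul_assoc _ _ _⟩⟩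
  have hmk : ∀ a, Ideal.Quotient.mk I a = 0 ↔ ∃ y, a = π • y := fun a => by
    rw [Ideal.Quotient.eq_zero_iff_mem, hmem]
  have hsimple : ∀ (J : TwoSidedIdeal (A ⧸ I)) (a : A), Ideal.Quotient.mk I a ∈ J →
      Ideal.Quotient.mk I a ≠ 0 → J = ⊤ := by
    intro J a haJ ha
    obtain ⟨φ, hφ⟩ := IsAzumaya.exists_end_apply_eq_one hπ ((hmk a).not.1 ha)
    -- Endomorphisms of `A` are sums of two-sided multiplications, so `φ` carries the ideal of `a`
    -- into itself and puts `1` there.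
    obtain ⟨t, rfl⟩ := (IsAzumaya.bij (R := R) (A := A)).2 φ
    have hJ : ∀ t, Ideal.Quotient.mk I (AlgHom.mulLeftRight R A t a) ∈ J := by
      intro t
      induction t with
      | zero => simp [J.zero_mem]
      | tmul p q =>
        rw [AlgHom.mulLeftRight_apply, map_mul, map_mul]
        exact J.mul_mem_right _ _ (J.mul_mem_left _ _ haJ)
      | add s t hs ht =>
        rw [map_add, LinearMap.add_apply, map_add]
        exact J.add_mem hs ht
    have h1 := hJ t
    rw [hφ, map_one] at h1
    exact (TwoSidedIdeal.one_mem_iff J).1 h1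
  have hnt : Nontrivial (A ⧸ I) := ⟨Ideal.Quotient.mk I x, 0, (hmk x).not.2 hx⟩
  have hsr : IsSimpleRing (A ⧸ I) := ⟨⟨fun J => by
    by_cases h : ∃ q ∈ J, q ≠ 0
    · obtain ⟨q, hq, hq0⟩ := h
      obtain ⟨a, rfl⟩ := Ideal.Quotient.mk_surjective q
      exact Or.inr (hsimple J a hq hq0)
    · push Not at h
      exact Or.inl (le_bot_iff.1 fun q hq => (TwoSidedIdeal.mem_bot _).2 (h q hq))⟩⟩
  have hart : IsArtinianRing (A ⧸ I) := by
    have htors : Module.IsTorsionBySet R (A ⧸ I) (IsLocalRing.maximalIdeal R) := by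
      rintro q ⟨r, hr⟩
      obtain ⟨a, rfl⟩ := Ideal.Quotient.mk_surjective q
      rw [hπ.maximalIdeal_eq, SetLike.mem_coe, Ideal.mem_span_singleton] at hr
      obtain ⟨s, rfl⟩ := hr
      exact (hmk _).2 ⟨s • a, mul_smul _ _ _⟩
    let : Module (R ⧸ IsLocalRing.maximalIdeal R) (A ⧸ I) := htors.module
    have : IsScalarTower R (R ⧸ IsLocalRing.maximalIdeal R) (A ⧸ I) := htors.isScalarTower
    have : IsScalarTower (R ⧸ IsLocalRing.maximalIdeal R) (A ⧸ I) (A ⧸ I) := ⟨fun r a b => by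
      obtain ⟨r, rfl⟩ := Ideal.Quotient.mk_surjective r
      exact smul_mul_assoc r a b⟩
    let : Field (R ⧸ IsLocalRing.maximalIdeal R) := Ideal.Quotient.field _
    have : Module.Finite R (A ⧸ I) :=
      Module.Finite.of_surjective (Ideal.Quotient.mkₐ R I).toLinearMap
        Ideal.Quotient.mk_surjective
    have : Module.Finite (R ⧸ IsLocalRing.maximalIdeal R) (A ⧸ I) :=
      Module.Finite.of_restrictScalars_finite R _ _
    have : IsArtinian (R ⧸ IsLocalRing.maximalIdeal R) (A ⧸ I) := inferInstance
    exact isArtinian_of_tower (R ⧸ IsLocalRing.maximalIdeal R) ‹_›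
  have hss : IsSemisimpleRing (A ⧸ I) :=
    IsSimpleRing.isSemisimpleRing_iff_isArtinianRing.2 hart
  obtain ⟨e', he', hspan⟩ := IsSemisimpleRing.ideal_eq_span_idempotent
    (Ideal.span {Ideal.Quotient.mk I x})
  obtain ⟨e, rfl⟩ := Ideal.Quotient.mk_surjective e'
  obtain ⟨y, hy⟩ := (hmk (e * e - e)).1 (by rw [map_sub, map_mul, he'.eq, sub_self])
  have hxe : Ideal.Quotient.mk I x ∈ Ideal.span {Ideal.Quotient.mk I e} :=
    hspan ▸ Ideal.mem_span_singleton_self _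
  have hex : Ideal.Quotient.mk I e ∈ Ideal.span {Ideal.Quotient.mk I x} :=
    hspan ▸ Ideal.mem_span_singleton_self _
  rw [Ideal.mem_span_singleton'] at hxe hex
  rcases hid e y hy with h | h
  · obtain ⟨c, hc⟩ := hxe
    rw [(hmk e).2 h, mul_zero] at hc
    exact absurd ((hmk x).1 hc.symm) hx
  · obtain ⟨c, hc⟩ := hex
    obtain ⟨c, rfl⟩ := Ideal.Quotient.mk_surjective c
    have he1 : Ideal.Quotient.mk I e = 1 := by
      have := (hmk (1 - e)).2 h
      rw [map_sub, map_one, sub_eq_zero] at this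
      exact this.symm
    obtain ⟨z, hz⟩ := (hmk (c * x - 1)).1 (by rw [map_sub, map_mul, hc, he1, map_one, sub_self])
    have hcx : c * x = 1 + π • z := by rw [← hz]; abel
    -- The unit criterion concerns left factors: it is applied to `c`, then to `c * x` with right
    -- factor `1`.
    obtain ⟨v, rfl⟩ := isUnit_of_mul_eq_one_add_smul hπ.not_isUnit hcx
    exact (Units.isUnit_units_mul v x).1
      (isUnit_of_mul_eq_one_add_smul hπ.not_isUnit (by rw [mul_one, hcx]))

end Azumaya

/-! ### Lattices and denominators. -/

section Lattice

variable {R F M V ι : Type*} [CommRing R] [Field F] [Algebra R F] [IsFractionRing R F]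
  [AddCommGroup M] [Module R M] [AddCommGroup V] [Module R V] [Module F V] [IsScalarTower R F V]

theorem LinearMap.injective_of_map_basis (f : M →ₗ[R] V) (b : Module.Basis ι R M)
    (c : Module.Basis ι F V) (h : ∀ i, f (b i) = c i) : Function.Injective f := by
  have hrepr : ∀ m i, c.repr (f m) i = algebraMap R F (b.repr m i) := by
    intro m i
    classical
    refine LinearMap.congr_fun (f := (c.coord i).restrictScalars R ∘ₗ f)
      (g := Algebra.linearMap R F ∘ₗ b.coord i) (b.ext fun k => ?_) m
    simp [h, Finsupp.single_apply, apply_ite (algebraMap R F)]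
  intro x y hxy
  apply b.repr.injective
  ext i
  apply IsFractionRing.injective R F
  rw [← hrepr, ← hrepr, hxy]

theorem IsDiscreteValuationRing.exists_pow_smul_mem_of_span_eq_top [IsDomain R]
    [IsDiscreteValuationRing R] {π : R} (hπ : Irreducible π) (N : Submodule R V)
    (hN : Submodule.span F (N : Set V) = ⊤) (v : V) : ∃ n : ℕ, π ^ n • v ∈ N := by
  have hv : v ∈ Submodule.span F (N : Set V) := hN ▸ trivial
  induction hv using Submodule.span_induction with
  | mem x hx => exact ⟨0, by simpa using hx⟩
  | zero => exact ⟨0, by simp⟩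
  | add x y _ _ hx hy =>
    obtain ⟨m, hm⟩ := hx
    obtain ⟨n, hn⟩ := hy
    refine ⟨m + n, ?_⟩
    rw [smul_add]
    refine N.add_mem ?_ ?_
    · rw [add_comm, pow_add, mul_smul]
      exact N.smul_mem _ hm
    · rw [pow_add, mul_smul]
      exact N.smul_mem _ hn
  | smul a x _ hx =>
    obtain ⟨n, hn⟩ := hx
    obtain ⟨r, s, hs, rfl⟩ := IsFractionRing.div_surjective (A := R) a
    have hs0 : s ≠ 0 := nonZeroDivisors.ne_zero hs
    obtain ⟨m, w, rfl⟩ := IsDiscreteValuationRing.eq_unit_mul_pow_irreducible hs0 hπ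
    refine ⟨m + n, ?_⟩
    have hs1 : algebraMap R F (w * π ^ m) ≠ 0 := by
      simpa using (IsFractionRing.injective R F).ne hs0
    have hw : algebraMap R F (↑w⁻¹ : R) * algebraMap R F (w : R) = 1 := by
      rw [← map_mul, Units.inv_mul, map_one]
    have h : π ^ (m + n) • (algebraMap R F r / algebraMap R F (w * π ^ m)) • x =
        (r * (↑w⁻¹ : R)) • π ^ n • x := by
      rw [← smul_assoc, smul_smul, ← algebraMap_smul F (r * _ * _) x, Algebra.smul_def]
      congr 1
      rw [mul_div_assoc', div_eq_iff hs1]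
      simp only [map_mul, map_pow, pow_add]
      linear_combination -(algebraMap R F π ^ m * algebraMap R F π ^ n * algebraMap R F r) * hw
    rw [h]
    exact N.smul_mem _ hn

end Lattice

/-! ### Units of the quaternion extension. -/

section QuaternionRelations

variable {R A T : Type*} [CommRing R] [Ring A] [Algebra R A] [Ring T] [Algebra R T]

/-- `T = A ⊕ Ai ⊕ Aj ⊕ Aij` as an extension of the `R`-algebra `A` by quaternion generators with
`i² = u`, `j² = π`, `ij = -ji`, together with an `R`-linear projection to `A` killing `Ai`. -/
structure QuatExt (u π : R) (ι : A →ₐ[R] T) (i j : T) (pr : T →ₗ[R] A) : Prop where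
  i_mul_i : i * i = u • 1
  j_mul_j : j * j = π • 1
  j_mul_i : j * i = -(i * j)
  i_comm : ∀ a, i * ι a = ι a * i
  j_comm : ∀ a, j * ι a = ι a * j
  exists_coord : ∀ x, ∃ a b c d, x = ι a + ι b * i + (ι c + ι d * i) * j
  pr_coe : ∀ a, pr (ι a) = a
  pr_mul_i : ∀ a, pr (ι a * i) = 0

namespace QuatExt

variable {u π : R} {ι : A →ₐ[R] T} {i j : T} {pr : T →ₗ[R] A}

theorem injective (h : QuatExt u π ι i j pr) : Function.Injective ι :=
  Function.LeftInverse.injective h.pr_coe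

/-- Conjugation by `j` fixes `A` and sends `i` to `-i`. This makes `(zj)²` and `(jz)²` multiples of
`π`. -/
theorem exists_conj (h : QuatExt u π ι i j pr) (z : T) : ∃ z', j * z = z' * j := by
  obtain ⟨a, b, c, d, rfl⟩ := h.exists_coord z
  refine ⟨ι a - ι b * i + (ι c - ι d * i) * j, ?_⟩
  have h1 : ∀ a, j * (ι a * i) = -(ι a * i * j) := fun a => by
    rw [← mul_assoc, h.j_comm, mul_assoc, h.j_mul_i, mul_neg, mul_assoc]
  rw [mul_add, mul_add, ← mul_assoc j (_ + _), mul_add j (ι c), h1, h1, h.j_comm, h.j_comm]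
  noncomm_ring

variable [IsLocalRing R] [Module.Finite R T] [Nontrivial T]

omit [Ring A] [Algebra R A] in
theorem _root_.one_ne_smul_of_not_isUnit (hπ : ¬ IsUnit π) (z : T) [IsDedekindFiniteMonoid T] :
    (1 : T) ≠ π • z := by
  intro hz
  have : IsUnit (0 : T) := isUnit_of_mul_eq_one_add_smul (y := 0) (z := -z) hπ (by
    rw [smul_neg, ← hz]; simp)
  exact not_isUnit_zero this

variable [NoZeroDivisors T]

theorem isUnit_coe_add_coe_mul_i (h : QuatExt u π ι i j pr) (hπ : ¬ IsUnit π) (hu : IsUnit u)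
    (h2 : IsUnit (2 : R))
    (hid : ∀ e y : T, e * e - e = π • y → (∃ z, e = π • z) ∨ ∃ z, 1 - e = π • z)
    (hA : ∀ a : A, (¬ ∃ y, a = π • y) → IsUnit a) {a b : A}
    (hab : ¬ ((∃ y, a = π • y) ∧ ∃ y, b = π • y)) : IsUnit (ι a + ι b * i) := by
  have hTd : IsDomain T := (isDomain_iff_noZeroDivisors_and_nontrivial T).2 ⟨‹_›, ‹_›⟩
  by_cases hb : ∃ y, b = π • y
  · obtain ⟨v, rfl⟩ := hA a fun ha => hab ⟨ha, hb⟩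
    obtain ⟨y, rfl⟩ := hb
    refine isUnit_of_mul_eq_one_add_smul (y := ι ↑v⁻¹) (z := ι y * i * ι ↑v⁻¹) hπ ?_
    rw [add_mul, ← map_mul, Units.mul_inv, map_one, map_smul, smul_mul_assoc, smul_mul_assoc]
  obtain ⟨v, rfl⟩ := hA b hb
  obtain ⟨c, rfl⟩ : ∃ c, ↑v * c = a := ⟨↑v⁻¹ * a, Units.mul_inv_cancel_left v a⟩
  rw [map_mul, ← mul_add]
  refine (v.isUnit.map ι).mul ?_
  have hprod : (ι c + i) * (ι c - i) = ι (c * c - u • 1) := by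
    rw [map_sub, map_mul, map_smul, map_one, ← h.i_mul_i, add_mul, mul_sub, mul_sub, h.i_comm]
    abel
  -- If `c² ≡ u` modulo `π`, then `(ci)² ≡ u²`, so `(1 + u⁻¹ci)/2` is idempotent modulo `π`. Its
  -- projection `1/2` to `A` shows that it is neither `0` nor `1` there.
  by_cases hc : ∃ t, c * c - u • 1 = π • t
  · exfalso
    obtain ⟨t, ht⟩ := hc
    obtain ⟨w, rfl⟩ := hu
    obtain ⟨s, hs⟩ := h2
    have hcc : c * c = (w : R) • 1 + π • t := by rw [← ht]; abel
    have hss : (ι c * i) * (ι c * i) = (w : R) • ((w : R) • 1 + π • ι t) := by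
      rw [mul_assoc, ← mul_assoc i, h.i_comm, mul_assoc, h.i_mul_i, ← mul_assoc, ← map_mul, hcc]
      simp
    have he1 : pr ((↑s⁻¹ : R) • (1 + (↑w⁻¹ : R) • (ι c * i))) = (↑s⁻¹ : R) • 1 := by
      rw [map_smul, map_add, map_smul, h.pr_mul_i, smul_zero, add_zero, ← map_one ι, h.pr_coe]
    have hs2 : (↑s⁻¹ : R) + ↑s⁻¹ = 1 := by
      rw [← two_mul, ← hs, Units.mul_inv]
    have hcontra : ¬ ∃ z : A, (↑s⁻¹ : R) • (1 : A) = π • z := by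
      rintro ⟨z, hz⟩
      refine one_ne_smul_of_not_isUnit (T := T) hπ (ι ((s : R) • z)) ?_
      rw [← map_smul, smul_comm, ← hz, smul_smul, Units.mul_inv, one_smul, map_one]
    have hidem : ((↑s⁻¹ : R) • (1 + (↑w⁻¹ : R) • (ι c * i))) *
        ((↑s⁻¹ : R) • (1 + (↑w⁻¹ : R) • (ι c * i))) -
        (↑s⁻¹ : R) • (1 + (↑w⁻¹ : R) • (ι c * i)) =
        π • ((↑s⁻¹ : R) * ↑s⁻¹ * ↑w⁻¹) • ι t := by
      have hw : (↑w⁻¹ : R) * w = 1 := Units.inv_mul w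
      rw [smul_mul_smul_comm, add_mul, mul_add, mul_add, smul_mul_smul_comm, hss]
      simp only [mul_one, one_mul]
      match_scalars
      · linear_combination ↑s⁻¹ * hs2 + ↑s⁻¹ ^ 2 * (↑w⁻¹ * w + 1) * hw
      · linear_combination ↑s⁻¹ * ↑w⁻¹ * hs2
      · linear_combination ↑s⁻¹ ^ 2 * π * ↑w⁻¹ * hw
    rcases hid _ _ hidem with ⟨z, hz⟩ | ⟨z, hz⟩
    · exact hcontra ⟨pr z, by rw [← he1, hz, map_smul]⟩
    · refine hcontra ⟨pr z, ?_⟩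
      rw [← map_smul, ← hz, map_sub, he1, ← map_one ι, h.pr_coe, eq_sub_iff_add_eq, ← add_smul,
        hs2, one_smul]
  · obtain ⟨w, hw⟩ := hA _ hc
    refine isUnit_of_mul_eq_one_add_smul (y := (ι c - i) * ι ↑w⁻¹) (z := 0) hπ ?_
    rw [← mul_assoc, hprod, ← hw, ← map_mul, Units.mul_inv, map_one, smul_zero, add_zero]

theorem isUnit_or_exists_mul_j (h : QuatExt u π ι i j pr) (hπ : ¬ IsUnit π) (hu : IsUnit u)
    (h2 : IsUnit (2 : R))
    (hid : ∀ e y : T, e * e - e = π • y → (∃ z, e = π • z) ∨ ∃ z, 1 - e = π • z)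
    (hA : ∀ a : A, (¬ ∃ y, a = π • y) → IsUnit a) (x : T) :
    IsUnit x ∨ ∃ y, x = y * j := by
  have hTd : IsDomain T := (isDomain_iff_noZeroDivisors_and_nontrivial T).2 ⟨‹_›, ‹_›⟩
  obtain ⟨a, b, c, d, rfl⟩ := h.exists_coord x
  by_cases hab : (∃ y, a = π • y) ∧ ∃ y, b = π • y
  · obtain ⟨⟨a, rfl⟩, b, rfl⟩ := hab
    right
    -- Since `π = j²`, a multiple of `π` is a right multiple of `j`.
    refine ⟨(ι a + ι b * i) * j + (ι c + ι d * i), ?_⟩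
    rw [add_mul ((ι a + ι b * i) * j), mul_assoc _ j j, h.j_mul_j, mul_smul_comm, mul_one,
      map_smul, map_smul, smul_mul_assoc, smul_add]
  · left
    obtain ⟨v, hv⟩ := h.isUnit_coe_add_coe_mul_i hπ hu h2 hid hA hab
    rw [← hv]
    obtain ⟨z, hz⟩ : ∃ z, ↑v * z = ι c + ι d * i := ⟨_, Units.mul_inv_cancel_left v _⟩
    have hfac : (v : T) + (ι c + ι d * i) * j = v * (1 + z * j) := by
      rw [← hz, mul_add, mul_one, mul_assoc]
    rw [hfac]
    refine v.isUnit.mul ?_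
    obtain ⟨z', hz'⟩ := h.exists_conj z
    refine isUnit_of_mul_eq_one_add_smul (y := 1 - z * j) (z := -(z * z')) hπ ?_
    have : z * j * (z * j) = π • (z * z') := by
      rw [mul_assoc, ← mul_assoc j, hz', mul_assoc, h.j_mul_j, mul_smul_comm, mul_smul_comm,
        mul_one]
    rw [smul_neg, ← this]
    noncomm_ring

end QuatExt

end QuaternionRelations

/-! ### Every order lies in the image of `T`. -/

section OrderContainment

variable {R A T D : Type*} [CommRing R] [IsLocalRing R] [Ring A] [Algebra R A] [Ring T]
  [Algebra R T] [Module.Finite R T] [Nontrivial T] [NoZeroDivisors T] [Ring D] [Algebra R D]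
  {u π : R} {ι : A →ₐ[R] T} {i j : T} {pr : T →ₗ[R] A}

omit [IsLocalRing R] [Module.Finite R T] [Nontrivial T] [NoZeroDivisors T] in
theorem Submodule.FG.exists_pow_smul_mem {N N' : Submodule R D} (hN : N.FG)
    (h : ∀ d, ∃ n : ℕ, π ^ n • d ∈ N') : ∃ n : ℕ, ∀ d ∈ N, π ^ n • d ∈ N' := by
  induction N, hN using Submodule.fg_induction with
  | singleton x =>
    obtain ⟨n, hn⟩ := h x
    refine ⟨n, fun d hd => ?_⟩
    obtain ⟨r, rfl⟩ := Submodule.mem_span_singleton.1 hd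
    rw [smul_comm]
    exact N'.smul_mem _ hn
  | sup N₁ N₂ _ _ h₁ h₂ =>
    obtain ⟨m, hm⟩ := h₁
    obtain ⟨n, hn⟩ := h₂
    refine ⟨m + n, fun d hd => ?_⟩
    obtain ⟨x, hx, y, hy, rfl⟩ := Submodule.mem_sup.1 hd
    rw [smul_add]
    refine N'.add_mem ?_ ?_
    · rw [add_comm, pow_add, mul_smul]
      exact N'.smul_mem _ (hm x hx)
    · rw [pow_add, mul_smul]
      exact N'.smul_mem _ (hn y hy)

theorem QuatExt.le_range_of_fg (h : QuatExt u π ι i j pr) (hπ : ¬ IsUnit π)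
    (hT : ∀ x : T, IsUnit x ∨ ∃ y, x = y * j) (ψ : T →ₐ[R] D) (hψ : Function.Injective ψ)
    (hj : j ≠ 0) (hD : IsDivision D) (hden : ∀ d : D, ∃ n : ℕ, π ^ n • d ∈ ψ.range)
    (Λ : Subalgebra R D) (hΛ : (Subalgebra.toSubmodule Λ).FG) : Λ ≤ ψ.range := by
  classical
  have hTd : IsDomain T := (isDomain_iff_noZeroDivisors_and_nontrivial T).2 ⟨‹_›, ‹_›⟩
  obtain ⟨N, hN⟩ := hΛ.exists_pow_smul_mem (N' := Subalgebra.toSubmodule ψ.range) hden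
  intro d hd
  by_contra hdT
  have hJu : IsUnit (ψ j) := hD.2 _ ((map_ne_zero_iff ψ hψ).2 hj)
  have hex : ∃ n : ℕ, d * ψ j ^ n ∈ ψ.range := by
    obtain ⟨n, hn⟩ := hden d
    refine ⟨2 * n, ?_⟩
    rw [pow_mul, ← map_pow, pow_two, h.j_mul_j, map_smul, map_one, smul_pow, one_pow,
      mul_smul_comm, mul_one]
    exact hn
  have hn := Nat.find_spec hex
  have hmin := fun m => Nat.find_min hex (m := m)
  generalize Nat.find hex = n at hn hmin
  obtain - | n := n
  · exact hdT (by simpa using hn)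
  obtain ⟨w, hw⟩ := hn
  have hw : ψ w = d * ψ j ^ (n + 1) := hw
  rcases hT w with ⟨w, rfl⟩ | ⟨y, rfl⟩
  -- A unit `w = d j ^ (n + 1)` gives `d⁻¹ = jz`, whence `d⁻² ∈ πT`.
  · have hdz : d * ψ (j * (j ^ n * ↑w⁻¹)) = 1 := by
      rw [← mul_assoc, ← pow_succ', map_mul, map_pow, ← mul_assoc, ← hw, ← map_mul,
        Units.mul_inv, map_one]
    generalize j ^ n * ↑w⁻¹ = z at hdz
    obtain ⟨z', hz'⟩ := h.exists_conj z
    have hjz : j * z * (j * z) = π • (z' * z) := by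
      nth_rw 1 [hz']
      rw [mul_assoc, ← mul_assoc j, h.j_mul_j, smul_mul_assoc, one_mul, mul_smul_comm]
    have hq : d * d * ψ (π • (z' * z)) = 1 := by
      rw [← hjz, map_mul, mul_assoc, ← mul_assoc d (ψ _), hdz, one_mul, hdz]
    have hpow : ∀ m : ℕ, (d * d) ^ m * ψ ((π • (z' * z)) ^ m) = 1 := by
      intro m
      induction m with
      | zero => simp
      | succ m ih =>
        rw [pow_succ, pow_succ', map_mul, mul_assoc, ← mul_assoc (d * d), hq, one_mul, ih]
    -- `π ^ N` clears the denominator of `d ^ (2(N + 1))`, while the inverse is divisible by `π ^ (N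
    -- + 1)`; the spare factor puts `1` in `πT`.
    obtain ⟨x, hx⟩ := hN _ (Λ.pow_mem (Λ.mul_mem hd hd) (N + 1))
    have hx : ψ x = π ^ N • (d * d) ^ (N + 1) := hx
    refine one_ne_smul_of_not_isUnit hπ (x * (z' * z) ^ (N + 1)) (hψ ?_)
    rw [map_one, map_smul, map_mul, hx, ← hpow (N + 1), smul_pow, map_smul, smul_mul_assoc,
      smul_smul, mul_smul_comm, pow_succ' π]
  -- Cancelling `j` contradicts the minimality of the exponent.
  · refine hmin n n.lt_succ_self ⟨y, ?_⟩
    change ψ y = _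
    apply hJu.mul_left_injective
    change ψ y * ψ j = d * ψ j ^ n * ψ j
    rw [← map_mul, hw, pow_succ, mul_assoc]

end OrderContainment

/-! ### The tensor product as a quaternion extension. -/

section TensorModel

variable {R : Type*} (A : Type*) [CommRing R] [Ring A] [Algebra R A] (u π : R)

theorem quatExt_tensorProduct :
    QuatExt u π (Algebra.TensorProduct.includeLeft : A →ₐ[R] A ⊗[R] ℍ[R, u, π])
      (1 ⊗ₜ ⟨0, 1, 0, 0⟩) (1 ⊗ₜ ⟨0, 0, 1, 0⟩)
      ((TensorProduct.rid R A).toLinearMap ∘ₗ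
        LinearMap.lTensor A (QuaternionAlgebra.reₗ u 0 π)) where
  i_mul_i := by
    rw [Algebra.TensorProduct.tmul_mul_tmul, Algebra.TensorProduct.one_def,
      ← TensorProduct.tmul_smul]
    congr 1
    · simp
    · ext <;> simp
  j_mul_j := by
    rw [Algebra.TensorProduct.tmul_mul_tmul, Algebra.TensorProduct.one_def,
      ← TensorProduct.tmul_smul]
    congr 1
    · simp
    · ext <;> simp
  j_mul_i := by
    rw [Algebra.TensorProduct.tmul_mul_tmul, Algebra.TensorProduct.tmul_mul_tmul,
      ← TensorProduct.tmul_neg]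
    congr 1
    ext <;> simp
  i_comm a := by simp
  j_comm a := by simp
  exists_coord x := by
    induction x with
    | zero => exact ⟨0, 0, 0, 0, by simp⟩
    | tmul p q =>
      refine ⟨q.re • p, q.imI • p, q.imJ • p, q.imK • p, ?_⟩
      have hq : q = q.re • 1 + q.imI • ⟨0, 1, 0, 0⟩ +
          (q.imJ • 1 + q.imK • ⟨0, 1, 0, 0⟩) * ⟨0, 0, 1, 0⟩ := by
        ext <;> simp
      conv_lhs => rw [hq]
      simp only [add_mul, smul_mul_assoc, one_mul, TensorProduct.tmul_add,
        TensorProduct.tmul_smul, Algebra.TensorProduct.includeLeft_apply,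
        Algebra.TensorProduct.tmul_mul_tmul, mul_one, TensorProduct.smul_tmul']
    | add x y hx hy =>
      obtain ⟨a, b, c, d, rfl⟩ := hx
      obtain ⟨a', b', c', d', rfl⟩ := hy
      refine ⟨a + a', b + b', c + c', d + d', ?_⟩
      simp only [map_add, add_mul]
      abel
  pr_coe a := by simp
  pr_mul_i a := by simp

end TensorModel

/-! ### Comparison of bases and the main theorem. -/

section Main

theorem QuaternionAlgebra.basisOneIJK_apply {R : Type*} [CommRing R] (a b c : R) (l : Fin 4) :
    basisOneIJK a b c l = (equivTuple a b c).symm (Pi.single l 1) := by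
  rw [basisOneIJK, Module.Basis.coe_ofEquivFun, coe_linearEquivTuple_symm]

variable {R F Γ₀ : Type*} [CommRing R] [Field F] [Algebra R F]
  [Ring Γ₀] [Algebra R Γ₀] [Module.Free R Γ₀] (a b : R)

omit [Module.Free R Γ₀] in
theorem quatTwistMap_basis {ι : Type*} (c : Module.Basis ι R Γ₀) (k : ι × Fin 4) :
    (quatTwistMap F Γ₀ a b).toLinearMap
        (c.tensorProduct (QuaternionAlgebra.basisOneIJK a 0 b) k) =
      (Algebra.TensorProduct.basis F c).tensorProduct
        (QuaternionAlgebra.basisOneIJK (algebraMap R F a) 0 (algebraMap R F b)) k := by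
  obtain ⟨k, l⟩ := k
  rw [Module.Basis.tensorProduct_apply, Module.Basis.tensorProduct_apply, AlgHom.toLinearMap_apply,
    quatTwistMap_tmul, Algebra.TensorProduct.basis_apply]
  congr 1
  rw [QuaternionAlgebra.basisOneIJK_apply, QuaternionAlgebra.basisOneIJK_apply]
  fin_cases l <;> ext <;> simp [quatMap]

theorem quatTwistMap_injective [IsFractionRing R F] :
    Function.Injective (quatTwistMap F Γ₀ a b) :=
  LinearMap.injective_of_map_basis _ _ _
    (quatTwistMap_basis (F := F) a b (Module.Free.chooseBasis R Γ₀))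

theorem span_range_quatTwistMap :
    Submodule.span F ((quatTwistMap F Γ₀ a b).range : Set (QuatTwist F Γ₀ a b)) = ⊤ := by
  rw [← top_le_iff, ← ((Algebra.TensorProduct.basis F (Module.Free.chooseBasis R Γ₀)).tensorProduct
    (QuaternionAlgebra.basisOneIJK (algebraMap R F a) 0 (algebraMap R F b))).span_eq]
  refine Submodule.span_mono ?_
  rintro _ ⟨k, rfl⟩
  rw [← quatTwistMap_basis]
  exact ⟨_, rfl⟩

end Main

theorem IsDivision.isDomain {A : Type*} [Ring A] (h : IsDivision A) : IsDomain A := by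
  refine (isDomain_iff_noZeroDivisors_and_nontrivial A).2 ⟨⟨fun {x y} hxy => ?_⟩, h.1⟩
  by_contra! hne
  exact hne.2 ((h.2 x hne.1).mul_right_eq_zero.1 hxy)

theorem eq_smul_or_one_sub_eq_smul_of_sq_sub_eq_smul {R B : Type*} [CommRing R] [Ring B]
    [IsDomain B] [Algebra R B] [Module.Free R B] [Module.Finite R B] {I : Ideal R} {π : R}
    [IsAdicComplete I R] (hI : I = Ideal.span {π}) (e y : B) (he : e * e - e = π • y) :
    (∃ z, e = π • z) ∨ ∃ z, 1 - e = π • z := by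
  obtain ⟨L, hL, z, hz⟩ := exists_isIdempotentElem_lift hI e y he
  rcases IsIdempotentElem.iff_eq_zero_or_one.1 hL with rfl | rfl
  · exact Or.inl ⟨-z, by rw [smul_neg, ← hz]; abel⟩
  · exact Or.inr ⟨z, hz⟩

theorem mainTheorem11 {R F Γ₀ : Type*} [CommRing R] [IsDomain R] [IsDiscreteValuationRing R]
    [IsAdicComplete (IsLocalRing.maximalIdeal R) R] [Field F] [Algebra R F] [IsFractionRing R F]
    (hchar : ringChar (IsLocalRing.ResidueField R) ≠ 2)
    [Ring Γ₀] [Algebra R Γ₀] [IsAzumaya R Γ₀]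
    (u π : R) (hu : IsUnit u) (hπ : Irreducible π)
    (hD : IsDivision (QuatTwist F Γ₀ u π)) :
    Function.Injective (quatTwistMap F Γ₀ u π) ∧
      IsMaximalOrderIn R F (quatTwistMap F Γ₀ u π).range ∧
      ∀ Λ : Subalgebra R (QuatTwist F Γ₀ u π),
        IsMaximalOrderIn R F Λ → Λ = (quatTwistMap F Γ₀ u π).range := by
  have hinj : Function.Injective (quatTwistMap F Γ₀ u π) := quatTwistMap_injective u π
  have hspan := span_range_quatTwistMap (F := F) (Γ₀ := Γ₀) u π
  have hord : IsOrderIn R F (quatTwistMap F Γ₀ u π).range := by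
    refine ⟨?_, hspan⟩
    rw [← Algebra.map_top]
    exact (Module.Finite.fg_top (R := R) (M := Γ₀ ⊗[R] ℍ[R, u, π])).map
      (quatTwistMap F Γ₀ u π).toLinearMap
  have hDdom := hD.isDomain
  have hTdom : IsDomain (Γ₀ ⊗[R] ℍ[R, u, π]) := hinj.isDomain (quatTwistMap F Γ₀ u π)
  have hquat := quatExt_tensorProduct Γ₀ u π
  have hAdom : IsDomain Γ₀ :=
    hquat.injective.isDomain (Algebra.TensorProduct.includeLeft : Γ₀ →ₐ[R] Γ₀ ⊗[R] ℍ[R, u, π])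
  have hmax := hπ.maximalIdeal_eq
  have h2 : IsUnit (2 : R) := by
    rw [← IsLocalRing.residue_ne_zero_iff_isUnit, map_ofNat]
    exact Ring.two_ne_zero hchar
  have hA : ∀ a : Γ₀, (¬ ∃ y, a = π • y) → IsUnit a := fun a =>
    IsAzumaya.isUnit_of_not_smul hπ (eq_smul_or_one_sub_eq_smul_of_sq_sub_eq_smul hmax)
  have hT := hquat.isUnit_or_exists_mul_j hπ.not_isUnit hu h2
    (eq_smul_or_one_sub_eq_smul_of_sq_sub_eq_smul hmax) hA
  have hj : (1 ⊗ₜ ⟨0, 0, 1, 0⟩ : Γ₀ ⊗[R] ℍ[R, u, π]) ≠ 0 := by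
    intro h0
    have h1 := hquat.j_mul_j
    rw [h0, mul_zero] at h1
    exact smul_ne_zero hπ.ne_zero one_ne_zero h1.symm
  have hle : ∀ Λ : Subalgebra R (QuatTwist F Γ₀ u π), IsOrderIn R F Λ →
      Λ ≤ (quatTwistMap F Γ₀ u π).range := fun Λ hΛ =>
    hquat.le_range_of_fg hπ.not_isUnit hT _ hinj hj hD
      (IsDiscreteValuationRing.exists_pow_smul_mem_of_span_eq_top (F := F) hπ
        (Subalgebra.toSubmodule (quatTwistMap F Γ₀ u π).range) hspan) Λ hΛ.fg
  exact ⟨hinj, ⟨hord, fun Λ' hΛ' hΛ => le_antisymm hΛ (hle Λ' hΛ')⟩,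
    fun Λ hΛ => hΛ.eq_of_le _ hord (hle Λ hΛ.isOrder)⟩
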